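/- Let $G$ be a finite simple undirected connected graph of order $n$ with minimum degree $\delta$. Then $$tpc(G)\le \frac{3n}{\delta+1}+1.$$ Here a total-coloring of $G$ assigns a color to every vertex and every edge of $G$. A path in a total-colored graph is a total proper path if (i) any two adjacent edges on the path differ in color, (ii) any two internal adjacent vertices on the path differ in color, and (iii) any internal vertex of the path differs in color from its incident edges on the path. The total proper connection number $tpc(G)$ is the smallest number of colors in a total-coloring of $G$ for which any two vertices of $G$ are connected by a total proper path. -/

import Mathlib

namespace SimpleGraph

/-- A total-coloring of the vertices and edges of a graph on `V` with colors in `α`; it need not be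
proper in any sense. The edge coloring is a function on all unordered pairs, but only its values on
edges of the graph are ever used. -/
structure TotalColoring (V α : Type*) where
  /-- the color of a vertex -/
  vertex : V → α
  /-- the color of an edge -/
  edge : Sym2 V → α

variable {V α : Type*}

/-- A total proper path `v₀ v₁ … v_ℓ`. The internal vertices are `v_{i+1}` with `i + 1 < ℓ`. -/
structure Walk.IsTotalProperPath {G : SimpleGraph V} {u v : V} (p : G.Walk u v)
    (c : TotalColoring V α) : Prop where
  /-- it is a path -/
  isPath : p.IsPath
  /-- consecutive edges of the path differ in color -/
  edge_ne_edge : ∀ i, i + 1 < p.length →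
    c.edge s(p.getVert i, p.getVert (i + 1)) ≠ c.edge s(p.getVert (i + 1), p.getVert (i + 2))
  /-- consecutive internal vertices of the path differ in color -/
  vertex_ne_vertex : ∀ i, i + 2 < p.length →
    c.vertex (p.getVert (i + 1)) ≠ c.vertex (p.getVert (i + 2))
  /-- an internal vertex differs in color from the edge of the path that precedes it -/
  vertex_ne_edge_left : ∀ i, i + 1 < p.length →
    c.vertex (p.getVert (i + 1)) ≠ c.edge s(p.getVert i, p.getVert (i + 1))
  /-- an internal vertex differs in color from the edge of the path that follows it -/
  vertex_ne_edge_right : ∀ i, i + 1 < p.length →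
    c.vertex (p.getVert (i + 1)) ≠ c.edge s(p.getVert (i + 1), p.getVert (i + 2))

/-- The total-coloring `c` makes `G` total proper connected. -/
def IsTotalProperConnected (G : SimpleGraph V) (c : TotalColoring V α) : Prop :=
  ∀ u v : V, ∃ p : G.Walk u v, p.IsTotalProperPath c

/-- The total proper connection number: the least number `k` of colors such that some
total-coloring with `k` available colors makes `G` total proper connected. -/
noncomputable def tpc (G : SimpleGraph V) : ℕ :=
  sInf {k : ℕ | ∃ c : TotalColoring V (Fin k), G.IsTotalProperConnected c}

/-- For a finite connected graph the minimum in the definition of `tpc` is over a nonempty set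
(give all vertices and edges distinct colors), so it is attained. -/
theorem Connected.exists_totalColoring_tpc [Finite V] {G : SimpleGraph V} (hG : G.Connected) :
    ∃ c : TotalColoring V (Fin G.tpc), G.IsTotalProperConnected c := by
  classical
  have hne : {k : ℕ | ∃ c : TotalColoring V (Fin k), G.IsTotalProperConnected c}.Nonempty := by
    have : Fintype V := Fintype.ofFinite V
    let e := Fintype.equivFin (V ⊕ Sym2 V)
    refine ⟨_, ⟨fun x => e (Sum.inl x), fun x => e (Sum.inr x)⟩, fun u v => ?_⟩
    obtain ⟨p, hp⟩ := hG.exists_isPath u v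
    have inj : ∀ i j, i ≤ p.length → j ≤ p.length → i ≠ j → p.getVert i ≠ p.getVert j :=
      fun i j hi hj hij h => hij (hp.getVert_injOn hi hj h)
    refine ⟨p, hp, fun i hi => ?_, fun i hi => ?_, fun i hi => ?_, fun i hi => ?_⟩
    · have h1 := inj i (i + 1) (by omega) (by omega) (by omega)
      have h2 := inj i (i + 2) (by omega) (by omega) (by omega)
      simp [h1, h2]
    · have h1 := inj (i + 1) (i + 2) (by omega) (by omega) (by omega)
      simpa using h1
    · simp
    · simp
  exact Nat.sInf_mem hne

end SimpleGraph

namespace SimpleGraph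

/-! ### Distances and edge exchange in trees -/

section Tree

variable {V : Type*} {T : SimpleGraph V}

/-! It suffices to find a spanning tree of maximum degree `k` with `k * (δ + 1) ≤ 3 * n`: trees can
be totally colored properly and greedily, and tree paths then join all pairs. Take a tree minimizing
`∑ 4 ^ degree` among connected spanning subgraphs, a vertex `v` of maximum degree `k`, and `X` the
vertices of degree at least `k - 1`. By minimality no edge of `G` outside `X` leaves a branch at `v`
(`sum_pow_degree_exchange_lt`), so the closed neighborhood of a leaf lies in its branch together
with `X`. Summing over branches gives a bound that is good when `X` is small
(`degree_mul_minDegree_le`); the degree sum handles large `X` (`card_mul_add_two_le`). -/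

/-- A walk avoids every vertex `v` that is farther from its end than the walk is long. -/
theorem Walk.notMem_support_of_length_lt_dist {a b v : V} (q : T.Walk a b)
    (h : q.length < T.dist v b) : v ∉ q.support := by
  classical
  intro hv
  have h1 := dist_le (q.dropUntil v hv)
  have h2 := q.length_dropUntil_le_length hv
  omega

/-- In a tree, at most one neighbor of `a` is not farther from `b` than `a` is. -/
theorem IsTree.eq_of_adj_of_dist_le (hT : T.IsTree) {a b z z' : V} (hz : T.Adj a z)
    (hz' : T.Adj a z') (h : T.dist z b ≤ T.dist a b) (h' : T.dist z' b ≤ T.dist a b) :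
    z = z' := by
  have key : ∀ z, T.Adj a z → T.dist z b ≤ T.dist a b → ∃ p : T.Walk a b, p.IsPath ∧ p.snd = z := by
    intro z hz h
    -- Adjacent vertices of a tree are never equidistant from `b`, so `h` is strict and the geodesic
    -- from `z` misses `a`.
    have hne := hT.dist_ne_of_adj b hz
    rw [dist_comm, dist_comm (u := b)] at hne
    obtain ⟨q, hq, hl⟩ := hT.connected.exists_path_of_dist z b
    have hs : a ∉ q.support := q.notMem_support_of_length_lt_dist (by omega)
    exact ⟨.cons hz q, (Walk.cons_isPath_iff _ _).2 ⟨hq, hs⟩, by simp⟩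
  obtain ⟨p, hp, rfl⟩ := key z hz h
  obtain ⟨q, hq, rfl⟩ := key z' hz' h'
  rw [(hT.existsUnique_path a b).unique hp hq]

/-- Removing an edge `v w` from a connected graph and joining a vertex closer to `w` than to `v`
with one that is not keeps the graph connected. -/
theorem Connected.deleteEdges_sup_edge (hT : T.Connected) {v w x y : V} (hvw : T.Adj v w)
    (hx : T.dist w x < T.dist v x) (hy : T.dist v y ≤ T.dist w y) :
    (T.deleteEdges {s(v, w)} ⊔ edge x y).Connected := by
  classical
  set H := T.deleteEdges {s(v, w)} ⊔ edge x y with hH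
  have hxy : x ≠ y := by rintro rfl; omega
  have hle : T.deleteEdges {s(v, w)} ≤ H := le_sup_left
  have hwu : ∀ u, T.dist w u < T.dist v u → H.Reachable w u := by
    intro u hu
    obtain ⟨q, -, hl⟩ := hT.exists_path_of_dist w u
    have hs : v ∉ q.support := q.notMem_support_of_length_lt_dist (by omega)
    exact ((q.toDeleteEdges {s(v, w)} fun e he h => hs (by
      rw [Set.mem_singleton_iff.1 h] at he
      exact q.fst_mem_support_of_mem_edges he)).reachable).mono hle
  have hvu : ∀ u, T.dist v u ≤ T.dist w u → H.Reachable v u := by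
    intro u hu
    obtain ⟨q, hq, hl⟩ := hT.exists_path_of_dist v u
    -- A geodesic from `v` through `w` would have length at least `1 + T.dist w u`, which exceeds
    -- `T.dist v u`.
    refine ((q.toDeleteEdges {s(v, w)} fun e he h => ?_).reachable).mono hle
    rw [Set.mem_singleton_iff.1 h] at he
    have hw := q.snd_mem_support_of_mem_edges he
    have h1 := dist_le (q.dropUntil w hw)
    have h2 : (q.takeUntil w hw).length + (q.dropUntil w hw).length = q.length := by
      rw [← Walk.length_append, q.take_spec]
    have h3 := dist_le (q.takeUntil w hw)
    have h4 : T.dist v w = 1 := dist_eq_one_iff_adj.2 hvw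
    omega
  have hadj : H.Adj x y := Or.inr ((edge_adj _ _ _ _).2 ⟨Or.inl ⟨rfl, rfl⟩, hxy⟩)
  have hvw' : H.Reachable v w := (hvu y hy).trans (hadj.symm.reachable.trans (hwu x hx).symm)
  refine connected_iff_exists_forall_reachable _ |>.2 ⟨v, fun u => ?_⟩
  rcases lt_or_ge (T.dist w u) (T.dist v u) with h | h
  · exact hvw'.trans (hwu u h)
  · exact hvu u h

end Tree

/-! ### A spanning tree of small maximum degree -/

section DegreeBound

variable {V : Type*} [Fintype V] {T : SimpleGraph V}

open scoped Classical in
/-- Each branch of a finite tree at a vertex `v` has a vertex of degree at most one. -/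
theorem IsTree.exists_degree_le_one_of_adj (hT : T.IsTree) {v w : V} (hvw : T.Adj v w) :
    ∃ u, T.dist w u < T.dist v u ∧ T.degree u ≤ 1 := by
  have hne : (Finset.univ.filter fun u => T.dist w u < T.dist v u).Nonempty :=
    ⟨w, by simpa using hT.connected.pos_dist_of_ne hvw.ne⟩
  obtain ⟨u, hu, hmax⟩ := Finset.exists_max_image _ (fun u => T.dist v u) hne
  simp only [Finset.mem_filter, Finset.mem_univ, true_and] at hu hmax
  refine ⟨u, hu, ?_⟩
  -- A neighbor farther from `v` than `u` would lie in the same branch, against the choice of `u` as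
  -- farthest.
  have hclose : ∀ z, T.Adj u z → T.dist z v ≤ T.dist u v := by
    intro z hz
    by_contra! hlt
    rw [dist_comm, dist_comm (u := z)] at hlt
    have h1 := hT.connected.dist_triangle (u := w) (v := u) (w := z)
    have h2 : T.dist u z = 1 := dist_eq_one_iff_adj.2 hz
    have := hmax z (by omega)
    omega
  rw [← card_neighborFinset_eq_degree, Finset.card_le_one]
  intro a ha b hb
  rw [mem_neighborFinset] at ha hb
  exact hT.eq_of_adj_of_dist_le ha hb (hclose a ha) (hclose b hb)

open scoped Classical in
/-- If no vertex of a branch outside `X` has a neighbor outside both the branch and `X`, then the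
branch has many vertices outside `X`. -/
theorem IsTree.minDegree_lt_card_branch_add {G : SimpleGraph V} (hT : T.IsTree)
    {v w : V} (hvw : T.Adj v w) (X : Finset V) (hX : ∀ u, T.degree u ≤ 1 → u ∉ X)
    (hclosed : ∀ x y, T.dist w x < T.dist v x → x ∉ X → y ∉ X → G.Adj x y →
      T.dist w y < T.dist v y) :
    G.minDegree + 1 ≤
      (Xᶜ.filter fun u => T.dist w u < T.dist v u).card + X.card := by
  obtain ⟨u, hu, hdeg⟩ := hT.exists_degree_le_one_of_adj hvw
  have huX := hX u hdeg
  have hsub : insert u (G.neighborFinset u) ⊆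
      (Xᶜ.filter fun u => T.dist w u < T.dist v u) ∪ X := by
    intro z hz
    by_cases hzX : z ∈ X
    · simp [hzX]
    rcases Finset.mem_insert.1 hz with rfl | hz
    · simp [hzX, hu]
    · have := hclosed u z hu huX hzX ((mem_neighborFinset _ _ _).1 hz)
      simp [hzX, this]
  have h1 := Finset.card_le_card hsub
  rw [Finset.card_insert_of_notMem (by simp), card_neighborFinset_eq_degree] at h1
  have h2 := G.minDegree_le_degree u
  have h3 := Finset.card_union_le (Xᶜ.filter fun u => T.dist w u < T.dist v u) X
  omega

open scoped Classical in
/-- The sum form of `minDegree_lt_card_branch_add` over all branches at `v`. -/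
theorem IsTree.degree_mul_minDegree_le {G : SimpleGraph V} (hT : T.IsTree)
    {v : V} (X : Finset V) (hX : ∀ u, T.degree u ≤ 1 → u ∉ X)
    (hclosed : ∀ w x y, T.Adj v w → T.dist w x < T.dist v x → x ∉ X → y ∉ X → G.Adj x y →
      T.dist w y < T.dist v y) :
    T.degree v * (G.minDegree + 1) + X.card ≤ Fintype.card V + T.degree v * X.card := by
  have h1 : ∑ w ∈ T.neighborFinset v, (G.minDegree + 1) ≤ ∑ w ∈ T.neighborFinset v,
      ((Xᶜ.filter fun u => T.dist w u < T.dist v u).card + X.card) :=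
    Finset.sum_le_sum fun w hw =>
      have hvw := (mem_neighborFinset _ _ _).1 hw
      hT.minDegree_lt_card_branch_add hvw X hX fun x y => hclosed w x y hvw
  have h2 : ∑ w ∈ T.neighborFinset v, (Xᶜ.filter fun u => T.dist w u < T.dist v u).card
      ≤ Xᶜ.card := by
    rw [← Finset.card_biUnion]
    · exact Finset.card_le_card (Finset.biUnion_subset.2 fun _ _ => Finset.filter_subset _ _)
    · intro w hw w' hw' hne
      refine Finset.disjoint_left.2 fun u hu hu' => hne ?_
      simp only [Finset.mem_filter] at hu hu'
      exact hT.eq_of_adj_of_dist_le ((mem_neighborFinset _ _ _).1 hw)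
        ((mem_neighborFinset _ _ _).1 hw') hu.2.le hu'.2.le
  rw [Finset.sum_const, Finset.sum_add_distrib, Finset.sum_const, card_neighborFinset_eq_degree,
    smul_eq_mul, smul_eq_mul] at h1
  have h3 := Finset.card_compl_add_card X
  omega

open scoped Classical in
/-- Vertices of degree greater than `d` are few in a tree. -/
theorem IsTree.card_mul_add_two_le (hT : T.IsTree) (hcard : 2 ≤ Fintype.card V) (X : Finset V)
    (d : ℕ) (hX : ∀ u ∈ X, d + 1 ≤ T.degree u) : X.card * d + 2 ≤ Fintype.card V := by
  have hnt : Nontrivial V := Fintype.one_lt_card_iff_nontrivial.1 hcard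
  have h1 := T.sum_degrees_eq_twice_card_edges
  have h2 := hT.card_edgeFinset
  have h3 : ∑ u, (1 + if u ∈ X then d else 0) ≤ ∑ u, T.degree u := by
    refine Finset.sum_le_sum fun u _ => ?_
    split_ifs with h
    · have := hX u h
      omega
    · exact hT.connected.preconnected.degree_pos_of_nontrivial u
  rw [Finset.sum_add_distrib, Finset.sum_ite_mem, Finset.univ_inter, Finset.sum_const,
    Finset.sum_const, smul_eq_mul, smul_eq_mul, Finset.card_univ] at h3
  omega

open scoped Classical in
/-- Replacing an edge at a vertex of maximum degree `k` by an edge between two vertices of degree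
at most `k - 2` lowers the sum of `4 ^ degree`. -/
theorem sum_pow_degree_exchange_lt {H : SimpleGraph V} {v w x y : V}
    (hH : H = T.deleteEdges {s(v, w)} ⊔ edge x y) (hvw : T.Adj v w) (hxv : x ≠ v) (hyv : y ≠ v)
    (hx : T.degree x + 2 ≤ T.degree v) (hy : T.degree y + 2 ≤ T.degree v) :
    ∑ u, 4 ^ H.degree u < ∑ u, 4 ^ T.degree u := by
  have hadj : ∀ a b, H.Adj a b → T.Adj a b ∧ s(a, b) ≠ s(v, w) ∨
      (a = x ∧ b = y ∨ a = y ∧ b = x) := by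
    intro a b h
    rw [hH] at h
    rcases h with h | h
    · exact Or.inl (by simpa [deleteEdges_adj] using h)
    · have := ((edge_adj _ _ _ _).1 h).1
      grind
  have hv : H.degree v + 1 ≤ T.degree v := by
    simp only [← card_neighborFinset_eq_degree]
    rw [← Finset.card_erase_add_one ((mem_neighborFinset _ _ _).2 hvw)]
    refine Nat.succ_le_succ (Finset.card_le_card fun b hb => ?_)
    have := hadj v b ((mem_neighborFinset _ _ _).1 hb)
    simp only [Finset.mem_erase, mem_neighborFinset]
    grind
  have hother : ∀ u, u ≠ x → u ≠ y → H.degree u ≤ T.degree u := by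
    intro u hux huy
    simp only [← card_neighborFinset_eq_degree]
    refine Finset.card_le_card fun b hb => ?_
    have := hadj u b ((mem_neighborFinset _ _ _).1 hb)
    simp only [mem_neighborFinset]
    grind
  have hnew : ∀ a b, (a = x ∧ b = y ∨ a = y ∧ b = x) → H.degree a ≤ T.degree a + 1 := by
    intro a b hab
    simp only [← card_neighborFinset_eq_degree]
    refine (Finset.card_le_card (t := insert b (T.neighborFinset a)) fun c hc => ?_).trans
      (Finset.card_insert_le _ _)
    have := hadj a c ((mem_neighborFinset _ _ _).1 hc)
    simp only [Finset.mem_insert, mem_neighborFinset]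
    grind
  obtain ⟨m, hm⟩ : ∃ m, T.degree v = m + 1 := ⟨T.degree v - 1, by omega⟩
  -- The loss at `v` is at least `3 * 4 ^ m`, while `x` and `y` end with degree at most `m` and gain
  -- at most `4 ^ m` each; base 4 makes the loss win.
  have hpt : ∀ u, 4 ^ H.degree u + (if u = v then 3 * 4 ^ m else 0) ≤
      4 ^ T.degree u + ((if u = x then 4 ^ m else 0) + if u = y then 4 ^ m else 0) := by
    intro u
    by_cases huv : u = v
    · subst huv
      have : 4 ^ H.degree u ≤ 4 ^ m := Nat.pow_le_pow_right (by norm_num) (by omega)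
      simp only [if_true, hm, pow_succ]
      omega
    · by_cases hux : u = x
      · have h1 := hnew u y (Or.inl ⟨hux, rfl⟩)
        have : 4 ^ H.degree u ≤ 4 ^ m :=
          Nat.pow_le_pow_right (by norm_num) (by subst hux; omega)
        rw [if_neg huv, if_pos hux]
        generalize 4 ^ T.degree u = t
        omega
      · by_cases huy : u = y
        · have h1 := hnew u x (Or.inr ⟨huy, rfl⟩)
          have : 4 ^ H.degree u ≤ 4 ^ m :=
            Nat.pow_le_pow_right (by norm_num) (by subst huy; omega)
          rw [if_neg huv, if_pos huy]
          generalize 4 ^ T.degree u = t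
          omega
        · have : 4 ^ H.degree u ≤ 4 ^ T.degree u :=
            Nat.pow_le_pow_right (by norm_num) (hother u hux huy)
          rw [if_neg huv]
          omega
  have hsum := Finset.sum_le_sum fun u (_ : u ∈ Finset.univ) => hpt u
  simp only [Finset.sum_add_distrib, Finset.sum_ite_eq', Finset.mem_univ, if_true] at hsum
  have : 0 < 4 ^ m := by positivity
  omega

open scoped Classical in
/-- A connected graph has a spanning tree of maximum degree at most `3 n / (δ + 1)`. -/
theorem Connected.exists_isTree_le_degree_mul_le {G : SimpleGraph V} (hG : G.Connected) :
    ∃ T ≤ G, T.IsTree ∧ ∀ v, T.degree v * (G.minDegree + 1) ≤ 3 * Fintype.card V := by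
  -- Minimizing over connected subgraphs rather than trees means an exchange need only preserve
  -- connectedness.
  obtain ⟨H, ⟨hHG, hH⟩, hmin⟩ := Set.exists_min_image {H : SimpleGraph V | H ≤ G ∧ H.Connected}
    (fun H => ∑ u, 4 ^ H.degree u) (Set.toFinite _) ⟨G, le_rfl, hG⟩
  obtain ⟨T, hTH, hT⟩ := hH.exists_isTree_le
  have hTG := hTH.trans hHG
  refine ⟨T, hTG, hT, ?_⟩
  have hTmin : ∀ T' ≤ G, T'.Connected → ∑ u, 4 ^ T.degree u ≤ ∑ u, 4 ^ T'.degree u :=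
    fun T' hle hc => (Finset.sum_le_sum fun u _ =>
      Nat.pow_le_pow_right (by norm_num) (degree_le_of_le hTH)).trans (hmin T' ⟨hle, hc⟩)
  have : Nonempty V := hG.nonempty
  obtain ⟨v, hv⟩ := T.exists_maximal_degree_vertex
  suffices h : T.degree v * (G.minDegree + 1) ≤ 3 * Fintype.card V from fun u =>
    (Nat.mul_le_mul_right _ (hv ▸ T.degree_le_maxDegree u)).trans h
  have hn : G.minDegree + 1 ≤ Fintype.card V := G.minDegree_lt_card
  rcases lt_or_ge (T.degree v) 4 with hk | hk
  · exact Nat.mul_le_mul (by omega) hn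
  obtain ⟨j, hj⟩ : ∃ j, T.degree v = j + 2 := ⟨T.degree v - 2, by omega⟩
  have hcard : 2 ≤ Fintype.card V := by
    have := T.degree_lt_card_verts v
    omega
  -- Outside `X` the degree is at most `T.degree v - 2`, as the exchange requires.
  set X : Finset V := Finset.univ.filter fun u => j + 1 ≤ T.degree u with hX
  have hA := hT.card_mul_add_two_le hcard X j (by simp [hX])
  have hB := hT.degree_mul_minDegree_le (G := G) (v := v) X (by simp [hX]; omega) (by
    intro w x y hvw hx hxX hyX hxy
    by_contra! hy
    simp only [hX, Finset.mem_filter, Finset.mem_univ, true_and] at hxX hyX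
    have hlt := sum_pow_degree_exchange_lt (x := x) (y := y) rfl hvw (by rintro rfl; omega)
      (by rintro rfl; omega) (by omega) (by omega)
    refine absurd (hTmin _ (sup_le ((deleteEdges_le _).trans hTG) ?_)
      (hT.connected.deleteEdges_sup_edge hvw hx hy)) (not_le.2 hlt)
    exact (edge_le_iff _).2 (Or.inr hxy))
  rw [hj] at hB ⊢
  generalize X.card = s at *
  generalize G.minDegree + 1 = D at *
  generalize Fintype.card V = n at *
  have hj2 : 2 ≤ j := by omega
  -- If `3 * s ≤ 2 * D`, then `hB` gives `(j + 4) * D ≤ 3 * n`. Otherwise `2 * D < 3 * s` and `j + 2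
  -- ≤ 2 * j` give `(j + 2) * D ≤ 3 * s * j`, and `hA` finishes.
  rcases le_or_gt (3 * s) (2 * D) with h | h
  · nlinarith
  · nlinarith

end DegreeBound

/-! ### Greedy total coloring of a tree -/

section Coloring

variable {V : Type*} [Fintype V] {T : SimpleGraph V}

open scoped Classical in
/-- A tree of maximum degree at most `k`, with `k ≥ 2`, has a proper total coloring with `k + 1`
colors. -/
theorem IsTree.exists_proper_totalColoring (hT : T.IsTree) {k : ℕ} (hk : 2 ≤ k)
    (hdeg : ∀ v, T.degree v ≤ k) : ∃ c : TotalColoring V (Fin (k + 1)),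
      (∀ a b, T.Adj a b → c.vertex a ≠ c.vertex b) ∧
      (∀ a b, T.Adj a b → c.vertex a ≠ c.edge s(a, b)) ∧
      (∀ a b d, T.Adj a b → T.Adj a d → b ≠ d → c.edge s(a, b) ≠ c.edge s(a, d)) := by
  obtain ⟨r⟩ := hT.connected.nonempty
  suffices h : ∀ S : Finset V, ∃ c : TotalColoring V (Fin (k + 1)),
      (∀ a ∈ S, ∀ b ∈ S, T.Adj a b → c.vertex a ≠ c.vertex b) ∧
      (∀ a ∈ S, ∀ b ∈ S, T.Adj a b → c.vertex a ≠ c.edge s(a, b)) ∧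
      (∀ a ∈ S, ∀ b ∈ S, ∀ d ∈ S, T.Adj a b → T.Adj a d → b ≠ d →
        c.edge s(a, b) ≠ c.edge s(a, d)) by
    simpa using h Finset.univ
  intro S
  -- Adding vertices by increasing distance from the root `r` gives each new vertex at most one
  -- colored neighbor.
  induction S using Finset.induction_on_max_value (fun a => T.dist a r) with
  | empty => exact ⟨⟨fun _ => 0, fun _ => 0⟩, by simp⟩
  | insert w S hw hmax ih =>
    obtain ⟨c, h1, h2, h3⟩ := ih
    by_cases hu : ∃ u ∈ S, T.Adj w u
    · obtain ⟨u, huS, hwu⟩ := hu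
      have huniq : ∀ z ∈ S, T.Adj w z → z = u := fun z hz hwz =>
        hT.eq_of_adj_of_dist_le hwz hwu (hmax z hz) (hmax u huS)
      -- The new edge avoids the color of `u` and of at most `k - 1` other edges at `u`, so `k + 1`
      -- colors suffice.
      obtain ⟨e, he⟩ : ∃ e, e ∉ insert (c.vertex u)
          (((T.neighborFinset u).erase w).image fun z => c.edge s(u, z)) := by
        by_contra! hall
        have hc := Finset.card_le_card (fun e _ => hall e : Finset.univ ⊆ _)
        have hc1 := Finset.card_insert_le (c.vertex u)
          (((T.neighborFinset u).erase w).image fun z => c.edge s(u, z))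
        have hc2 := Finset.card_image_le (s := (T.neighborFinset u).erase w)
          (f := fun z => c.edge s(u, z))
        have hc3 := Finset.card_erase_add_one ((mem_neighborFinset _ _ _).2 hwu.symm)
        have hc4 := hdeg u
        rw [card_neighborFinset_eq_degree] at hc3
        rw [Finset.card_univ, Fintype.card_fin] at hc
        omega
      -- A third color is needed here, hence `2 ≤ k`.
      obtain ⟨f, hf⟩ : ∃ f, f ∉ ({c.vertex u, e} : Finset (Fin (k + 1))) := by
        by_contra! hall
        have hc := Finset.card_le_card (fun e _ => hall e : Finset.univ ⊆ _)
        have hc1 := Finset.card_le_two (a := c.vertex u) (b := e)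
        rw [Finset.card_univ, Fintype.card_fin] at hc
        omega
      simp only [Finset.mem_insert, Finset.mem_image, Finset.mem_erase, mem_neighborFinset,
        Finset.mem_singleton, not_or, not_exists] at he hf
      have hwne : ∀ z ∈ S, z ≠ w := fun z hz h => hw (h ▸ hz)
      have hedge : ∀ a ∈ S, ∀ b ∈ S, s(a, b) ≠ s(w, u) := by
        intro a ha b hb h
        have := hwne a ha
        have := hwne b hb
        simp only [Sym2.eq_iff] at h
        grind
      refine ⟨⟨Function.update c.vertex w f, Function.update c.edge s(w, u) e⟩, ?_, ?_, ?_⟩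
      · intro a ha b hb hab
        have := hab.ne
        have := hab.symm
        simp only [Function.update_apply]
        grind
      · intro a ha b hb hab
        have := hab.ne
        have := hab.symm
        have : s(u, w) = s(w, u) := Sym2.eq_swap
        simp only [Function.update_apply]
        grind
      · intro a ha b hb d hd hab had hbd
        have := hab.ne
        have := had.ne
        have := hab.symm
        have := had.symm
        have : s(u, w) = s(w, u) := Sym2.eq_swap
        simp only [Function.update_apply]
        grind
    · push Not at hu
      have hu' : ∀ z ∈ S, ¬ T.Adj z w := fun z hz h => hu z hz h.symm
      have hww : ¬ T.Adj w w := T.loopless.irrefl w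
      refine ⟨c, ?_, ?_, ?_⟩ <;> grind

/-- A graph with a spanning tree of maximum degree at most `k`, with `k ≥ 2`, has total proper
connection number at most `k + 1`. -/
theorem IsTree.tpc_le {G : SimpleGraph V} [DecidableRel T.Adj] (hT : T.IsTree) (hle : T ≤ G)
    {k : ℕ} (hk : 2 ≤ k) (hdeg : ∀ v, T.degree v ≤ k) : G.tpc ≤ k + 1 := by
  classical
  obtain ⟨c, h1, h2, h3⟩ := hT.exists_proper_totalColoring hk (fun v => by convert hdeg v)
  refine Nat.sInf_le ⟨c, fun u v => ?_⟩
  obtain ⟨p, hp⟩ := hT.connected.exists_isPath u v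
  have hget : ∀ i, (p.mapLe hle).getVert i = p.getVert i := fun i => p.getVert_map _ i
  have hlen : (p.mapLe hle).length = p.length := p.length_map _
  have hadj : ∀ i, i < p.length → T.Adj (p.getVert i) (p.getVert (i + 1)) :=
    fun i hi => p.adj_getVert_succ hi
  refine ⟨p.mapLe hle, hp.mapLe hle, ?_, ?_, ?_, ?_⟩ <;> simp only [hget, hlen] <;> intro i hi
  · rw [Sym2.eq_swap]
    refine h3 _ _ _ (hadj i (by omega)).symm (hadj (i + 1) hi) fun h => ?_
    have := hp.getVert_injOn (Set.mem_ofPred_eq ▸ (by omega : i ≤ p.length))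
      (Set.mem_ofPred_eq ▸ (by omega : i + 2 ≤ p.length)) h
    omega
  · exact h1 _ _ (hadj (i + 1) (by omega))
  · rw [Sym2.eq_swap]
    exact h2 _ _ (hadj i (by omega)).symm
  · exact h2 _ _ (hadj (i + 1) hi)

end Coloring

end SimpleGraph

theorem theorem5 {V : Type*} [Fintype V] (G : SimpleGraph V) [DecidableRel G.Adj]
    (hG : G.Connected) :
    (G.tpc : ℝ) ≤ 3 * (Fintype.card V : ℝ) / ((G.minDegree : ℝ) + 1) + 1 := by
  classical
  obtain ⟨T, hle, hT, hdeg⟩ := hG.exists_isTree_le_degree_mul_le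
  have : Nonempty V := hG.nonempty
  have hn : G.minDegree + 1 ≤ Fintype.card V := G.minDegree_lt_card
  have hpos : 0 < G.minDegree + 1 := Nat.succ_pos _
  -- The quotient is at least 3 because `δ + 1 ≤ n`; rounding it down is harmless since degrees are
  -- integers.
  have h := hT.tpc_le hle (k := 3 * Fintype.card V / (G.minDegree + 1))
    ((Nat.le_div_iff_mul_le hpos).2 (by omega))
    fun v => (Nat.le_div_iff_mul_le hpos).2 (by convert hdeg v)
  calc (G.tpc : ℝ) ≤ ((3 * Fintype.card V / (G.minDegree + 1) : ℕ) : ℝ) + 1 := by exact_mod_cast h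
    _ ≤ _ := by
      gcongr
      exact Nat.cast_div_le.trans_eq (by push_cast; rfl)
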